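/- Let $G=(V,E)$ be a finite digraph with nonempty vertex set $V=\{v_1,\dots,v_n\}$; self-loops and multiple arcs are allowed. Let $A$ be its adjacency matrix, whose $(i,j)$ entry is the number of arcs from $v_i$ to $v_j$. Let $\rho(G)$ be the spectral radius of $A$, i.e. the maximum modulus of the complex eigenvalues of $A$. For an integer $k\ge 0$ let $d_i^{k+}=\sum_{j=1}^n (A^k)_{ij}$ be the $k$-outdegree of $v_i$ (so $d_i^{0+}=1$). For a strongly connected $G$, let $h(G)$ be the index of imprimitivity of $A$, i.e. the number of distinct eigenvalues of $A$ whose modulus equals $\rho(G)$. Let $G$ be strongly connected and have at least one arc. Suppose that for some integers $k\ge 0$ and $N\ge 0$ at least one of the two equalities $$\rho(G)=\min_{(v_i,v_j)\in E}\left(\frac{d_i^{(k+1)+}\,d_j^{(k+N)+}}{d_i^{k+}\,d_j^{k+}}\right)^{\frac1{N+1}},\qquad \rho(G)=\max_{(v_i,v_j)\in E}\left(\frac{d_i^{(k+1)+}\,d_j^{(k+N)+}}{d_i^{k+}\,d_j^{k+}}\right)^{\frac1{N+1}}$$ holds. Then $\rho(G)$ is the $r$-th root of a nonnegative integer, that is,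 $\rho(G)^r$ is a nonnegative integer, where $r=\gcd(N+1,h(G))$. -/

import Mathlib

/-! A finite digraph, with self-loops and multiple arcs allowed, is a quiver on a finite vertex
type `V` with finitely many arcs `i ⟶ j` between any two vertices. -/

namespace MultiDigraph

section Defs

universe v u

variable (V : Type u) [Fintype V] [DecidableEq V] [Quiver.{v} V]

/-- The adjacency matrix: the entry at `(i, j)` is the number of arcs from `i` to `j`. -/
noncomputable def adjMatrix : Matrix V V ℕ :=
  Matrix.of fun i j => Nat.card (i ⟶ j)

/-- The adjacency matrix, regarded as a complex matrix. -/
noncomputable def complexAdjMatrix : Matrix V V ℂ :=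
  (adjMatrix V).map (fun m : ℕ => (m : ℂ))

/-- The spectral radius of a digraph: the largest modulus of a complex eigenvalue of its
adjacency matrix. -/
noncomputable def rho : ℝ :=
  (spectralRadius ℂ (complexAdjMatrix V)).toReal

/-- The index of imprimitivity: the number of distinct eigenvalues of the adjacency matrix whose
modulus equals the spectral radius. -/
noncomputable def imprimitivityIndex : ℕ :=
  {μ : ℂ | μ ∈ spectrum ℂ (complexAdjMatrix V) ∧ ‖μ‖ = rho V}.ncard

variable {V}

/-- The `k`-outdegree of the vertex `i`: the `i`-th row sum of the `k`-th power of the adjacency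
matrix. It is `1` for `k = 0`. -/
noncomputable def outdegree (k : ℕ) (i : V) : ℕ :=
  ∑ j, (adjMatrix V ^ k) i j

variable (V)

/-- The set of values over which the arc-based bounds on the spectral radius take the minimum and
the maximum. -/
def arcValues (k N : ℕ) : Set ℝ :=
  {x : ℝ | ∃ i j : V, Nonempty (i ⟶ j) ∧
    x = (((outdegree (k + 1) i : ℝ) * (outdegree (k + N) j : ℝ)) /
          ((outdegree k i : ℝ) * (outdegree k j : ℝ))) ^ ((1 : ℝ) / ((N : ℝ) + 1))}

end Defs

end MultiDigraph

/-!
Let `A` be the adjacency matrix, `ρ` its spectral radius, `h` the number of its eigenvalues of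
modulus `ρ`, and `d = A ^ k 1` the vector of `k`-outdegrees. Since the graph is strongly connected
and has an arc, `A` is irreducible, so `ρ` and the entries of `d` are positive.

If `ρ` is the smallest arc value, then `d_{k+1}(i) d_{k+N}(j) ≥ ρ ^ (N + 1) d_k(i) d_k(j)` for
every arc from `i` to `j`; summing over the arcs out of `i` and dividing by `d_{k+1}(i)` gives
`A ^ (N + 1) d ≥ ρ ^ (N + 1) d`. If `ρ` is the largest arc value, the inequality is reversed. In
either case irreducibility and the Collatz bounds (`Matrix.realSpectralRadius_pow_le`,
`Matrix.le_realSpectralRadius_pow`) force equality (`Matrix.IsIrreducible.pow_mulVec_eq_of_le`,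
`Matrix.IsIrreducible.pow_mulVec_eq_of_ge`), so `d` is an eigenvector of `A ^ (N + 1)`
(`MultiDigraph.pow_mulVec_outdegree_eq`).

For an eigenvalue `μ` of modulus `ρ`, equality in the triangle inequality makes the spectrum
invariant under multiplication by `μ / ρ`, whence `μ ^ h = ρ ^ h`
(`Matrix.IsIrreducible.div_pow_ncard_eq_one`). The eigenvalues of `A` that contribute to `d` satisfy
`μ ^ (N + 1) = ρ ^ (N + 1)`, hence also `μ ^ r = ρ ^ r` with `r = gcd (N + 1) h`; as the
polynomial `x ^ (N + 1) - ρ ^ (N + 1)` has only simple roots, it follows that `A ^ r d = ρ ^ r d`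
(`Matrix.IsIrreducible.pow_gcd_mulVec_eq`). So `ρ ^ r` is an eigenvalue of a natural matrix with a
natural eigenvector: it is a nonnegative rational and an algebraic integer, hence a natural number.
-/

/-! ### Real matrices and their spectral radius -/

namespace Matrix

variable {n : Type*} [Fintype n]

theorem map_ofReal_mulVec (A : Matrix n n ℝ) (v : n → ℝ) (i : n) :
    (A.map ((↑) : ℝ → ℂ) *ᵥ fun j => (v j : ℂ)) i = ((A *ᵥ v) i : ℝ) := by
  simp [mulVec, dotProduct]

theorem mulVec_mono_of_nonneg {B : Matrix n n ℝ} (hB : ∀ i j, 0 ≤ B i j) {v w : n → ℝ}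
    (h : v ≤ w) : B *ᵥ v ≤ B *ᵥ w := fun i =>
  Finset.sum_le_sum fun j _ => mul_le_mul_of_nonneg_left (h j) (hB i j)

theorem norm_map_ofReal_mulVec_le {B : Matrix n n ℝ} (hB : ∀ i j, 0 ≤ B i j) (v : n → ℂ) (i : n) :
    ‖(B.map ((↑) : ℝ → ℂ) *ᵥ v) i‖ ≤ (B *ᵥ fun j => ‖v j‖) i := by
  refine (norm_sum_le _ _).trans (Finset.sum_le_sum fun j _ => ?_)
  simp [abs_of_nonneg (hB i j)]

theorem exists_smul_le [Nonempty n] {f z : n → ℝ} (hz : ∀ i, 0 < z i) :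
    ∃ i, (f i / z i) • z ≤ f := by
  obtain ⟨i, hi⟩ := Finite.exists_min fun i => f i / z i
  exact ⟨i, fun j => (le_div_iff₀ (hz j)).1 (hi j)⟩

theorem exists_le_smul [Nonempty n] {f z : n → ℝ} (hz : ∀ i, 0 < z i) :
    ∃ i, f ≤ (f i / z i) • z := by
  obtain ⟨i, hi⟩ := Finite.exists_max fun i => f i / z i
  exact ⟨i, fun j => (div_le_iff₀ (hz j)).1 (hi j)⟩

variable [DecidableEq n]

/-- The spectral radius of a real square matrix, as a real number: the largest modulus of its
complex eigenvalues. -/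
noncomputable def realSpectralRadius (A : Matrix n n ℝ) : ℝ :=
  (spectralRadius ℂ (A.map ((↑) : ℝ → ℂ))).toReal

theorem map_ofReal_pow (A : Matrix n n ℝ) (m : ℕ) :
    (A ^ m).map ((↑) : ℝ → ℂ) = A.map ((↑) : ℝ → ℂ) ^ m :=
  Matrix.map_pow A Complex.ofRealHom m

theorem mem_spectrum_iff_exists_mulVec {K : Type*} [Field K] {B : Matrix n n K} {μ : K} :
    μ ∈ spectrum K B ↔ ∃ v : n → K, v ≠ 0 ∧ B *ᵥ v = μ • v := by
  rw [← spectrum_toLin', ← Module.End.hasEigenvalue_iff_mem_spectrum]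
  constructor
  · intro h
    obtain ⟨v, hv⟩ := h.exists_hasEigenvector
    exact ⟨v, hv.2, by simpa using hv.apply_eq_smul⟩
  · rintro ⟨v, hv, h⟩
    exact Module.End.hasEigenvalue_of_hasEigenvector
      (Module.End.hasEigenvector_iff.2 ⟨Module.End.mem_eigenspace_iff.2 (by simpa using h), hv⟩)

theorem spectralRadius_ne_top [Nonempty n] (B : Matrix n n ℂ) : spectralRadius ℂ B ≠ ⊤ := by
  let : NormedRing (Matrix n n ℂ) := Matrix.linftyOpNormedRing
  let : NormedAlgebra ℂ (Matrix n n ℂ) := Matrix.linftyOpNormedAlgebra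
  exact (lt_of_le_of_lt (spectrum.spectralRadius_le_nnnorm B) ENNReal.coe_lt_top).ne

theorem norm_le_realSpectralRadius [Nonempty n] {A : Matrix n n ℝ} {μ : ℂ}
    (hμ : μ ∈ spectrum ℂ (A.map ((↑) : ℝ → ℂ))) : ‖μ‖ ≤ realSpectralRadius A := by
  have h : (‖μ‖₊ : ENNReal) ≤ spectralRadius ℂ (A.map ((↑) : ℝ → ℂ)) :=
    le_iSup₂ (f := fun k (_ : k ∈ spectrum ℂ (A.map ((↑) : ℝ → ℂ))) => (‖k‖₊ : ENNReal)) μ hμ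
  simpa [realSpectralRadius] using ENNReal.toReal_mono (spectralRadius_ne_top _) h

theorem realSpectralRadius_nonneg (A : Matrix n n ℝ) : 0 ≤ realSpectralRadius A :=
  ENNReal.toReal_nonneg

theorem exists_norm_eq_realSpectralRadius [Nonempty n] (A : Matrix n n ℝ) :
    ∃ μ ∈ spectrum ℂ (A.map ((↑) : ℝ → ℂ)), ‖μ‖ = realSpectralRadius A := by
  let : NormedRing (Matrix n n ℂ) := Matrix.linftyOpNormedRing
  let : NormedAlgebra ℂ (Matrix n n ℂ) := Matrix.linftyOpNormedAlgebra
  obtain ⟨μ, hμ, h⟩ := spectrum.exists_nnnorm_eq_spectralRadius (A.map ((↑) : ℝ → ℂ))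
  exact ⟨μ, hμ, by simp [realSpectralRadius, ← h]⟩

theorem pow_mulVec_of_mulVec_eq_smul {R : Type*} [CommSemiring R] {B : Matrix n n R} {v : n → R}
    {μ : R} (h : B *ᵥ v = μ • v) (m : ℕ) : B ^ m *ᵥ v = μ ^ m • v := by
  induction m with
  | zero => simp
  | succ m ih => rw [pow_succ, ← mulVec_mulVec, h, mulVec_smul, ih, smul_smul, pow_succ']

/-! ### Collatz bounds -/

/-- The upper Collatz bound: compare the modulus of an eigenvector with `z` at an index where
their ratio is largest. -/
theorem realSpectralRadius_pow_le [Nonempty n] {A : Matrix n n ℝ} (hA : ∀ i j, 0 ≤ A i j)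
    {z : n → ℝ} (hz : ∀ i, 0 < z i) {m : ℕ} {c : ℝ} (h : A ^ m *ᵥ z ≤ c • z) :
    realSpectralRadius A ^ m ≤ c := by
  obtain ⟨μ, hμ, hρ⟩ := exists_norm_eq_realSpectralRadius A
  obtain ⟨v, hv, hAv⟩ := mem_spectrum_iff_exists_mulVec.1 hμ
  obtain ⟨i, hi⟩ := Finite.exists_max fun i => ‖v i‖ / z i
  set t := ‖v i‖ / z i with ht
  have hvt : (fun j => ‖v j‖) ≤ t • z := fun j => by
    have := hi j
    rw [div_le_iff₀ (hz j)] at this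
    simpa using this
  have hti : t * z i = ‖v i‖ := div_mul_cancel₀ _ (hz i).ne'
  have ht0 : 0 ≤ t := div_nonneg (norm_nonneg _) (hz i).le
  have htpos : 0 < ‖v i‖ := by
    obtain ⟨j, hj⟩ := Function.ne_iff.1 hv
    have h1 : 0 < ‖v j‖ := norm_pos_iff.2 hj
    have h2 := h1.trans_le (hvt j)
    rw [← hti]
    exact mul_pos (pos_of_mul_pos_left h2 (hz j).le) (hz i)
  have h1 := norm_map_ofReal_mulVec_le (pow_apply_nonneg hA m) v i
  rw [map_ofReal_pow, pow_mulVec_of_mulVec_eq_smul hAv, Pi.smul_apply, smul_eq_mul, norm_mul,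
    norm_pow, hρ] at h1
  have h2 := mulVec_mono_of_nonneg (pow_apply_nonneg hA m) hvt i
  have h3 : (A ^ m *ᵥ (t • z)) i ≤ c * ‖v i‖ := by
    rw [mulVec_smul, ← hti]
    have := mul_le_mul_of_nonneg_left (h i) ht0
    simp only [Pi.smul_apply, smul_eq_mul] at this ⊢
    linarith
  exact le_of_mul_le_mul_right (h1.trans (h2.trans h3)) htpos

theorem smul_le_pow_mulVec {B : Matrix n n ℝ} (hB : ∀ i j, 0 ≤ B i j)
    {z : n → ℝ} {c : ℝ} (hc : 0 ≤ c) (h : c • z ≤ B *ᵥ z) (m : ℕ) :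
    c ^ m • z ≤ B ^ m *ᵥ z := by
  induction m with
  | zero => simp
  | succ m ih =>
    rw [pow_succ' B, ← mulVec_mulVec]
    refine le_trans ?_ (mulVec_mono_of_nonneg hB ih)
    rw [mulVec_smul, pow_succ, ← smul_smul]
    exact smul_le_smul_of_nonneg_left h (pow_nonneg hc m)

/-- The lower Collatz bound. Iterating the hypothesis shows that the operator norms of the powers
of `A ^ m` dominate the powers of `c`, and Gelfand's formula applies. -/
theorem le_realSpectralRadius_pow [Nonempty n] {A : Matrix n n ℝ} (hA : ∀ i j, 0 ≤ A i j)
    {z : n → ℝ} (hz : ∀ i, 0 < z i) {m : ℕ} {c : ℝ} (hc : 0 ≤ c) (h : c • z ≤ A ^ m *ᵥ z) :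
    c ≤ realSpectralRadius A ^ m := by
  let : NormedRing (Matrix n n ℂ) := Matrix.linftyOpNormedRing
  let : NormedAlgebra ℂ (Matrix n n ℂ) := Matrix.linftyOpNormedAlgebra
  set C : Matrix n n ℂ := A.map ((↑) : ℝ → ℂ) with hC
  -- Evaluate at an index where `z` attains its maximum, the sup norm of `z`.
  have hnorm : ∀ k : ℕ, c ^ k ≤ ‖(C ^ m) ^ k‖ := fun k => by
    obtain ⟨i, hi⟩ := Finite.exists_max z
    have hzi : ‖fun j => (z j : ℂ)‖ ≤ z i :=
      (pi_norm_le_iff_of_nonneg (hz i).le).2 fun j => by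
        simpa [abs_of_pos (hz j)] using hi j
    have h1 := smul_le_pow_mulVec (pow_apply_nonneg hA m) hc h k i
    have h2 := (norm_le_pi_norm ((C ^ m) ^ k *ᵥ fun j => (z j : ℂ)) i).trans
      (linfty_opNorm_mulVec _ _)
    rw [hC, ← map_ofReal_pow, ← map_ofReal_pow, map_ofReal_mulVec, Complex.norm_real,
      map_ofReal_pow, map_ofReal_pow, ← hC] at h2
    have h3 := (le_abs_self _).trans (h2.trans (mul_le_mul_of_nonneg_left hzi (norm_nonneg _)))
    exact le_of_mul_le_mul_right (h1.trans h3) (hz i)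
  have hG := spectrum.pow_norm_pow_one_div_tendsto_nhds_spectralRadius (C ^ m)
  have hle : ENNReal.ofReal c ≤ spectralRadius ℂ (C ^ m) := by
    refine ge_of_tendsto hG (Filter.eventually_atTop.2 ⟨1, fun k hk => ?_⟩)
    refine ENNReal.ofReal_le_ofReal ?_
    have hk0 : (k : ℕ) ≠ 0 := by lia
    calc c = (c ^ k) ^ (1 / k : ℝ) := by
          rw [one_div, Real.pow_rpow_inv_natCast hc hk0]
      _ ≤ _ := Real.rpow_le_rpow (pow_nonneg hc k) (hnorm k) (by positivity)
  obtain ⟨ν, hν, hνr⟩ := spectrum.exists_nnnorm_eq_spectralRadius (C ^ m)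
  rw [spectrum.map_pow] at hν
  obtain ⟨μ, hμ, rfl⟩ := hν
  have h4 : c ≤ ‖μ‖ ^ m := by
    rw [← hνr] at hle
    have := ENNReal.toReal_mono ENNReal.coe_ne_top hle
    simpa [ENNReal.toReal_ofReal hc] using this
  exact h4.trans (pow_le_pow_left₀ (norm_nonneg _) (norm_le_realSpectralRadius hμ) m)

/-! ### Irreducible nonnegative matrices -/

/-- Some polynomial in an irreducible matrix maps nonzero nonnegative vectors to positive ones:
add up one power with a positive `(i, j)` entry for each pair `(i, j)`. -/
theorem IsIrreducible.exists_polynomial_mulVec_pos {A : Matrix n n ℝ} (hA : A.IsIrreducible) :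
    ∃ p : Polynomial ℝ, ∀ y : n → ℝ, 0 ≤ y → y ≠ 0 → ∀ i, 0 < (p.aeval A *ᵥ y) i := by
  choose k _ hk using (isIrreducible_iff_exists_pow_pos hA.nonneg).1 hA
  refine ⟨∑ a, ∑ b, Polynomial.X ^ k a b, fun y hy hy0 i => ?_⟩
  obtain ⟨j, hj⟩ := Function.ne_iff.1 hy0
  have hpos : 0 < (A ^ k i j) i j * y j := mul_pos (hk i j) (lt_of_le_of_ne (hy j) (Ne.symm hj))
  have hnn : ∀ a b l : n, 0 ≤ (A ^ k a b) i l * y l := fun a b l =>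
    mul_nonneg (pow_apply_nonneg hA.nonneg _ _ _) (hy l)
  have hnn' : ∀ a b : n, 0 ≤ (A ^ k a b *ᵥ y) i := fun a b =>
    Finset.sum_nonneg fun l _ => hnn a b l
  simp only [map_sum, map_pow, Polynomial.aeval_X, sum_mulVec, Finset.sum_apply]
  refine hpos.trans_le ?_
  calc (A ^ k i j) i j * y j ≤ (A ^ k i j *ᵥ y) i :=
        Finset.single_le_sum (f := fun l => (A ^ k i j) i l * y l)
          (fun l _ => hnn i j l) (Finset.mem_univ j)
    _ ≤ ∑ b, (A ^ k i b *ᵥ y) i :=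
        Finset.single_le_sum (f := fun b => (A ^ k i b *ᵥ y) i)
          (fun b _ => hnn' i b) (Finset.mem_univ j)
    _ ≤ ∑ a, ∑ b, (A ^ k a b *ᵥ y) i :=
        Finset.single_le_sum (f := fun a => ∑ b, (A ^ k a b *ᵥ y) i)
          (fun a _ => Finset.sum_nonneg fun b _ => hnn' a b) (Finset.mem_univ i)

theorem aeval_mulVec_pow_mulVec (A : Matrix n n ℝ) (p : Polynomial ℝ) (m : ℕ) (y : n → ℝ) :
    p.aeval A *ᵥ (A ^ m *ᵥ y) = A ^ m *ᵥ (p.aeval A *ᵥ y) := by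
  rw [mulVec_mulVec, mulVec_mulVec]
  congr 1
  rw [← Polynomial.aeval_X_pow (R := ℝ) A, ← map_mul, ← map_mul, mul_comm]

/-- If the inequality were strict somewhere, a positive polynomial in `A` would make it strict
everywhere, contradicting the lower Collatz bound. -/
theorem IsIrreducible.pow_mulVec_eq_of_le [Nonempty n] {A : Matrix n n ℝ} (hA : A.IsIrreducible)
    {y : n → ℝ} (hy : 0 ≤ y) (hy0 : y ≠ 0) {m : ℕ}
    (h : realSpectralRadius A ^ m • y ≤ A ^ m *ᵥ y) :
    A ^ m *ᵥ y = realSpectralRadius A ^ m • y := by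
  obtain ⟨p, hp⟩ := hA.exists_polynomial_mulVec_pos
  by_contra hne
  have hz := hp y hy hy0
  have hw := hp (A ^ m *ᵥ y - realSpectralRadius A ^ m • y) (sub_nonneg.2 h) (sub_ne_zero.2 hne)
  rw [mulVec_sub, mulVec_smul, aeval_mulVec_pow_mulVec] at hw
  obtain ⟨i, hi⟩ := exists_smul_le (f := A ^ m *ᵥ (p.aeval A *ᵥ y)) hz
  have hlt : realSpectralRadius A ^ m < (A ^ m *ᵥ (p.aeval A *ᵥ y)) i / (p.aeval A *ᵥ y) i := by
    rw [lt_div_iff₀ (hz i)]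
    simpa using hw i
  exact absurd (le_realSpectralRadius_pow hA.nonneg hz
    ((pow_nonneg (realSpectralRadius_nonneg A) m).trans hlt.le) hi) (not_le.2 hlt)

theorem IsIrreducible.pow_mulVec_eq_of_ge [Nonempty n] {A : Matrix n n ℝ} (hA : A.IsIrreducible)
    {y : n → ℝ} (hy : 0 ≤ y) (hy0 : y ≠ 0) {m : ℕ}
    (h : A ^ m *ᵥ y ≤ realSpectralRadius A ^ m • y) :
    A ^ m *ᵥ y = realSpectralRadius A ^ m • y := by
  obtain ⟨p, hp⟩ := hA.exists_polynomial_mulVec_pos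
  by_contra hne
  have hz := hp y hy hy0
  have hw := hp (realSpectralRadius A ^ m • y - A ^ m *ᵥ y) (sub_nonneg.2 h)
    (sub_ne_zero.2 (Ne.symm hne))
  rw [mulVec_sub, mulVec_smul, aeval_mulVec_pow_mulVec] at hw
  obtain ⟨i, hi⟩ := exists_le_smul (f := A ^ m *ᵥ (p.aeval A *ᵥ y)) hz
  have hlt : (A ^ m *ᵥ (p.aeval A *ᵥ y)) i / (p.aeval A *ᵥ y) i < realSpectralRadius A ^ m := by
    rw [div_lt_iff₀ (hz i)]
    simpa using hw i
  exact absurd (realSpectralRadius_pow_le hA.nonneg hz hi) (not_le.2 hlt)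

theorem IsIrreducible.mulVec_pos {A : Matrix n n ℝ} (hA : A.IsIrreducible) {z : n → ℝ}
    (hz : ∀ i, 0 < z i) (i : n) : 0 < (A *ᵥ z) i := by
  obtain ⟨k, hk, hpos⟩ := (isIrreducible_iff_exists_pow_pos hA.nonneg).1 hA i i
  obtain ⟨k, rfl⟩ := Nat.exists_eq_succ_of_ne_zero hk.ne'
  rw [pow_succ', mul_apply] at hpos
  obtain ⟨j, _, hj⟩ := Finset.exists_ne_zero_of_sum_ne_zero hpos.ne'
  have hij : 0 < A i j := lt_of_le_of_ne (hA.nonneg i j) (Ne.symm (left_ne_zero_of_mul hj))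
  exact Finset.sum_pos' (fun l _ => mul_nonneg (hA.nonneg i l) (hz l).le)
    ⟨j, Finset.mem_univ j, mul_pos hij (hz j)⟩

theorem IsIrreducible.pow_mulVec_pos {A : Matrix n n ℝ} (hA : A.IsIrreducible) {z : n → ℝ}
    (hz : ∀ i, 0 < z i) (m : ℕ) (i : n) : 0 < (A ^ m *ᵥ z) i := by
  induction m generalizing i with
  | zero => simpa using hz i
  | succ m ih => rw [pow_succ', ← mulVec_mulVec]; exact hA.mulVec_pos ih i

theorem IsIrreducible.realSpectralRadius_pos [Nonempty n] {A : Matrix n n ℝ}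
    (hA : A.IsIrreducible) : 0 < realSpectralRadius A := by
  have h1 : ∀ i : n, 0 < (1 : n → ℝ) i := fun _ => one_pos
  have hA1 := hA.mulVec_pos h1
  obtain ⟨i, hi⟩ := exists_smul_le (f := A *ᵥ 1) h1
  have hpos : 0 < (A *ᵥ 1) i / (1 : n → ℝ) i := div_pos (hA1 i) (h1 i)
  have := le_realSpectralRadius_pow (m := 1) hA.nonneg h1 hpos.le (by simpa using hi)
  exact hpos.trans_le (by simpa using this)

theorem IsIrreducible.pos_of_mulVec_eq_smul {A : Matrix n n ℝ} (hA : A.IsIrreducible)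
    {y : n → ℝ} (hy : 0 ≤ y) (hy0 : y ≠ 0) {c : ℝ} (h : A *ᵥ y = c • y) (i : n) : 0 < y i := by
  obtain ⟨j, hj⟩ := Function.ne_iff.1 hy0
  obtain ⟨k, _, hk⟩ := (isIrreducible_iff_exists_pow_pos hA.nonneg).1 hA i j
  have h1 : 0 < (A ^ k *ᵥ y) i :=
    Finset.sum_pos' (fun l _ => mul_nonneg (pow_apply_nonneg hA.nonneg k i l) (hy l))
      ⟨j, Finset.mem_univ j, mul_pos hk (lt_of_le_of_ne (hy j) (Ne.symm hj))⟩
  rw [pow_mulVec_of_mulVec_eq_smul h] at h1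
  exact lt_of_le_of_ne (hy i) fun h0 => by simp [← h0] at h1

/-! ### The peripheral spectrum -/

/-- The modulus of a peripheral eigenvector is a positive eigenvector for the spectral radius. -/
theorem IsIrreducible.mulVec_norm_eq [Nonempty n] {A : Matrix n n ℝ} (hA : A.IsIrreducible)
    {μ : ℂ} (hμ : ‖μ‖ = realSpectralRadius A) {v : n → ℂ} (hv : v ≠ 0)
    (h : A.map ((↑) : ℝ → ℂ) *ᵥ v = μ • v) :
    (A *ᵥ fun i => ‖v i‖) = realSpectralRadius A • (fun i => ‖v i‖) ∧ ∀ i, v i ≠ 0 := by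
  have hy : 0 ≤ fun i => ‖v i‖ := fun i => norm_nonneg _
  have hy0 : (fun i => ‖v i‖) ≠ 0 := fun h0 => hv (funext fun i => norm_eq_zero.1 (congrFun h0 i))
  have hle : realSpectralRadius A ^ 1 • (fun i => ‖v i‖) ≤ A ^ 1 *ᵥ fun i => ‖v i‖ := fun i => by
    have := norm_map_ofReal_mulVec_le hA.nonneg v i
    rw [h] at this
    simpa [hμ] using this
  have heq := hA.pow_mulVec_eq_of_le hy hy0 hle
  rw [pow_one, pow_one] at heq
  exact ⟨heq, fun i => norm_pos_iff.1 (hA.pos_of_mulVec_eq_smul hy hy0 heq i)⟩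

/-- Equality in the triangle inequality along each row: the phases `v i / ‖v i‖` of a peripheral
eigenvector are multiplied by `μ / ρ` along every nonzero entry of the matrix. -/
theorem IsIrreducible.exists_phase [Nonempty n] {A : Matrix n n ℝ} (hA : A.IsIrreducible)
    {μ : ℂ} (hμs : μ ∈ spectrum ℂ (A.map ((↑) : ℝ → ℂ))) (hμ : ‖μ‖ = realSpectralRadius A) :
    ∃ u : n → ℂ, (∀ i, u i ≠ 0) ∧
      ∀ i j, (A i j : ℂ) * u j = μ / realSpectralRadius A * u i * A i j := by
  obtain ⟨v, hv, h⟩ := mem_spectrum_iff_exists_mulVec.1 hμs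
  obtain ⟨hAy, hv0⟩ := hA.mulVec_norm_eq hμ hv h
  set ρ := realSpectralRadius A
  have hρ : 0 < ρ := hA.realSpectralRadius_pos
  have hρc : (ρ : ℂ) ≠ 0 := by exact_mod_cast hρ.ne'
  have hvc : ∀ i, (‖v i‖ : ℂ) ≠ 0 := fun i => by simpa using hv0 i
  refine ⟨fun i => v i / ‖v i‖, fun i => div_ne_zero (hv0 i) (hvc i), fun i j => ?_⟩
  set w : ℂ := μ / ρ * (v i / ‖v i‖) with hw
  have hwn : ‖w‖ = 1 := by
    simp [hw, hμ, abs_of_pos hρ, hρ.ne', hv0 i]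
  have hww : (starRingEnd ℂ) w * w = 1 := by
    rw [Complex.conj_mul', hwn]; norm_num
  have hwρ : w * (ρ * ‖v i‖) = μ * v i := by
    rw [hw]; field_simp [hvc i]
  -- The row sum of `A i l * (‖v l‖ - Re (conj w * v l))` vanishes, and its terms are nonnegative.
  have hterm : ∀ l, 0 ≤ A i l * (‖v l‖ - ((starRingEnd ℂ) w * v l).re) := fun l =>
    mul_nonneg (hA.nonneg i l) (sub_nonneg.2 ((Complex.re_le_norm _).trans (by simp [hwn])))
  have hsum : ∑ l, A i l * (‖v l‖ - ((starRingEnd ℂ) w * v l).re) = 0 := by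
    have h1 : ∑ l, A i l * ‖v l‖ = ρ * ‖v i‖ := congrFun hAy i
    have h2 : ∑ l, (A i l : ℂ) * v l = μ * v i := congrFun h i
    have h3 : ∑ l, A i l * ((starRingEnd ℂ) w * v l).re = ρ * ‖v i‖ := by
      have : ((starRingEnd ℂ) w * ∑ l, (A i l : ℂ) * v l).re
          = ∑ l, A i l * ((starRingEnd ℂ) w * v l).re := by
        rw [Finset.mul_sum, Complex.re_sum]
        refine Finset.sum_congr rfl fun l _ => ?_
        rw [mul_left_comm, Complex.re_ofReal_mul]
      rw [← this, h2, ← hwρ, ← mul_assoc, hww, one_mul]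
      simp
    simp only [mul_sub, Finset.sum_sub_distrib, h1, h3, sub_self]
  have h0 := (Finset.sum_eq_zero_iff_of_nonneg fun l _ => hterm l).1 hsum j (Finset.mem_univ j)
  rcases mul_eq_zero.1 h0 with h0 | h0
  · simp [h0]
  · have hn : ‖(starRingEnd ℂ) w * v j‖ = ‖v j‖ := by simp [hwn]
    have hre : ((starRingEnd ℂ) w * v j).re = ‖(starRingEnd ℂ) w * v j‖ := by rw [hn]; linarith
    have him := (Complex.re_eq_norm.1 hre)
    have hval : (starRingEnd ℂ) w * v j = ‖v j‖ := by
      rw [← hn]; exact Complex.eq_coe_norm_of_nonneg him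
    have hvj : v j = w * ‖v j‖ := by
      rw [← hval, ← mul_assoc, mul_comm w, hww, one_mul]
    have huj : v j / ‖v j‖ = w := (div_eq_iff (hvc j)).2 hvj
    change (A i j : ℂ) * (v j / ‖v j‖) = w * A i j
    rw [huj, mul_comm]

/-- Conjugation by the diagonal matrix of phases shows that the spectrum is invariant under
multiplication by `μ / ρ`, for every peripheral eigenvalue `μ`. -/
theorem IsIrreducible.mul_mem_spectrum [Nonempty n] {A : Matrix n n ℝ} (hA : A.IsIrreducible)
    {μ ν : ℂ} (hμs : μ ∈ spectrum ℂ (A.map ((↑) : ℝ → ℂ))) (hμ : ‖μ‖ = realSpectralRadius A)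
    (hν : ν ∈ spectrum ℂ (A.map ((↑) : ℝ → ℂ))) :
    μ / realSpectralRadius A * ν ∈ spectrum ℂ (A.map ((↑) : ℝ → ℂ)) := by
  obtain ⟨u, hu, hAu⟩ := hA.exists_phase hμs hμ
  obtain ⟨v, hv, h⟩ := mem_spectrum_iff_exists_mulVec.1 hν
  refine mem_spectrum_iff_exists_mulVec.2 ⟨fun i => u i * v i, fun h0 => hv ?_, ?_⟩
  · exact funext fun i => (mul_eq_zero.1 (congrFun h0 i)).resolve_left (hu i)
  · ext i
    have h2 : ∑ l, (A i l : ℂ) * v l = ν * v i := congrFun h i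
    calc ∑ l, (A i l : ℂ) * (u l * v l)
        = ∑ l, μ / realSpectralRadius A * u i * ((A i l : ℂ) * v l) :=
          Finset.sum_congr rfl fun l _ => by rw [← mul_assoc, hAu, mul_assoc]
      _ = μ / realSpectralRadius A * ν * (u i * v i) := by rw [← Finset.mul_sum, h2]; ring

/-- The peripheral spectrum of a real matrix: its complex eigenvalues of largest modulus. -/
def peripheralSpectrum (A : Matrix n n ℝ) : Set ℂ :=
  {μ : ℂ | μ ∈ spectrum ℂ (A.map ((↑) : ℝ → ℂ)) ∧ ‖μ‖ = realSpectralRadius A}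

theorem finite_peripheralSpectrum (A : Matrix n n ℝ) : (peripheralSpectrum A).Finite :=
  (Matrix.finite_spectrum (A.map ((↑) : ℝ → ℂ))).subset fun _ h => h.1

/-- Multiplication by `μ / ρ` permutes the peripheral spectrum, so comparing the product of all its
elements before and after gives `(μ / ρ) ^ h = 1`. -/
theorem IsIrreducible.div_pow_ncard_eq_one [Nonempty n] {A : Matrix n n ℝ} (hA : A.IsIrreducible)
    {μ : ℂ} (hμ : μ ∈ peripheralSpectrum A) :
    (μ / realSpectralRadius A) ^ (peripheralSpectrum A).ncard = 1 := by
  set ρ := realSpectralRadius A with hρdef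
  have hρ : 0 < ρ := hA.realSpectralRadius_pos
  set z := μ / ρ with hz
  have hzn : ‖z‖ = 1 := by simp [hz, hμ.2, ← hρdef, abs_of_pos hρ, hρ.ne']
  have hz0 : z ≠ 0 := norm_ne_zero_iff.1 (by rw [hzn]; exact one_ne_zero)
  have hmem : ∀ x, x ∈ (finite_peripheralSpectrum A).toFinset ↔ x ∈ peripheralSpectrum A :=
    fun x => (finite_peripheralSpectrum A).mem_toFinset
  rw [Set.ncard_eq_toFinset_card _ (finite_peripheralSpectrum A)]
  set T := (finite_peripheralSpectrum A).toFinset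
  have hmaps : Set.MapsTo (z * ·) T T := fun x hx => by
    have hx' := (hmem x).1 hx
    exact (hmem _).2 ⟨hA.mul_mem_spectrum hμ.1 hμ.2 hx'.1, by simp [hzn, hx'.2]⟩
  have hinj : Set.InjOn (z * ·) (T : Set ℂ) := (mul_right_injective₀ hz0).injOn
  have hprod : ∏ x ∈ T, z * x = ∏ x ∈ T, x :=
    Finset.prod_nbij (z * ·) hmaps hinj
      (Finset.surjOn_of_injOn_of_card_le _ hmaps hinj le_rfl) fun _ _ => rfl
  rw [Finset.prod_mul_distrib, Finset.prod_const] at hprod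
  refine mul_right_cancel₀ (Finset.prod_ne_zero_iff.2 fun x hx => ?_) (hprod.trans (one_mul _).symm)
  exact norm_ne_zero_iff.1 (by rw [((hmem x).1 hx).2]; exact hρ.ne')

/-- An eigenvector of `A ^ m` for `ρ ^ m` is one of `A ^ gcd(m, h)` for `ρ ^ gcd(m, h)`, where `h`
is the size of the peripheral spectrum. With `r = gcd(m, h)` and `m = r * k`, the polynomial
`(x ^ k - c ^ k) / (x - c)`, for `c = ρ ^ r`, is invertible at `A ^ r`: an eigenvalue `μ` of `A`
with `μ ^ m = ρ ^ m` is peripheral, hence satisfies `μ ^ h = ρ ^ h` and so `μ ^ r = c`, and at `c`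
the polynomial takes the nonzero value `k * c ^ (k - 1)`. -/
theorem IsIrreducible.pow_gcd_mulVec_eq [Nonempty n] {A : Matrix n n ℝ} (hA : A.IsIrreducible)
    {m : ℕ} (hm : 0 < m) {y : n → ℝ} (h : A ^ m *ᵥ y = realSpectralRadius A ^ m • y) :
    A ^ m.gcd (peripheralSpectrum A).ncard *ᵥ y
      = realSpectralRadius A ^ m.gcd (peripheralSpectrum A).ncard • y := by
  set ρ := realSpectralRadius A with hρdef
  have hρ : 0 < ρ := hA.realSpectralRadius_pos
  have hρc : (ρ : ℂ) ≠ 0 := by exact_mod_cast hρ.ne'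
  set r := m.gcd (peripheralSpectrum A).ncard with hr
  have hr0 : 0 < r := Nat.gcd_pos_of_pos_left _ hm
  obtain ⟨k, hk⟩ : r ∣ m := Nat.gcd_dvd_left _ _
  have hk0 : 0 < k := Nat.pos_of_ne_zero fun h0 => by simp [hk, h0] at hm
  set C : Matrix n n ℂ := A.map ((↑) : ℝ → ℂ) with hC
  set c : ℂ := (ρ : ℂ) ^ r with hc
  have hc0 : c ≠ 0 := pow_ne_zero _ hρc
  let s : Polynomial ℂ := ∑ i ∈ Finset.range k, Polynomial.X ^ i * Polynomial.C c ^ (k - 1 - i)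
  have hs : s * (Polynomial.X - Polynomial.C c) = Polynomial.X ^ k - Polynomial.C c ^ k :=
    (Commute.all _ _).geom_sum₂_mul k
  have hunit : IsUnit (s.aeval (C ^ r)) := by
    by_contra hnot
    rw [← spectrum.zero_mem_iff ℂ,
      spectrum.map_polynomial_aeval_of_nonempty _ _
        (by rw [spectrum.map_pow_of_pos _ hr0]
            exact ⟨_, Set.mem_image_of_mem _ (exists_norm_eq_realSpectralRadius A).choose_spec.1⟩),
      spectrum.map_pow_of_pos _ hr0] at hnot
    obtain ⟨_, ⟨μ, hμ, rfl⟩, hμs⟩ := hnot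
    simp only at hμs
    have h1 := congrArg (Polynomial.eval (μ ^ r)) hs
    simp only [Polynomial.eval_mul, Polynomial.eval_sub, Polynomial.eval_pow, Polynomial.eval_X,
      Polynomial.eval_C, hμs, zero_mul] at h1
    have h2 : μ ^ m = (ρ : ℂ) ^ m := by
      rw [hk, pow_mul, pow_mul]; exact sub_eq_zero.1 h1.symm
    have h3 : ‖μ‖ = ρ := by
      refine (pow_left_inj₀ (norm_nonneg _) hρ.le hm.ne').1 ?_
      rw [← norm_pow, h2]; simp [abs_of_pos hρ]
    have h4 : (μ / ρ) ^ r = 1 :=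
      pow_gcd_eq_one.2 ⟨by rw [div_pow, h2, div_self (pow_ne_zero _ hρc)],
        hA.div_pow_ncard_eq_one ⟨hμ, h3⟩⟩
    have h5 : μ ^ r = c := by
      rw [div_pow, div_eq_one_iff_eq (pow_ne_zero _ hρc)] at h4; exact h4
    have h6 : s.eval c = k * c ^ (k - 1) := by
      simp only [s, Polynomial.eval_finsetSum, Polynomial.eval_mul, Polynomial.eval_pow,
        Polynomial.eval_X, Polynomial.eval_C]
      exact geom_sum₂_self c k
    rw [h5, h6] at hμs
    exact mul_ne_zero (by exact_mod_cast hk0.ne') (pow_ne_zero _ hc0) hμs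
  let Y : n → ℂ := fun i => (y i : ℂ)
  have hY : (C ^ r) ^ k *ᵥ Y = c ^ k • Y := by
    rw [← pow_mul, ← hk, hC, ← map_ofReal_pow]
    ext i
    rw [map_ofReal_mulVec, h, hc, ← pow_mul, ← hk]
    simp [Y]
  have hzero : s.aeval (C ^ r) *ᵥ (C ^ r *ᵥ Y - c • Y) = 0 := by
    have h1 := congrArg (fun p => Polynomial.aeval (C ^ r) p *ᵥ Y) hs
    simp only [map_mul, map_sub, map_pow, Polynomial.aeval_X, Polynomial.aeval_C, sub_mulVec, hY,
      ← mulVec_mulVec, Algebra.algebraMap_eq_smul_one, smul_pow, one_pow, smul_mulVec,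
      one_mulVec, sub_self] at h1
    exact h1
  have hinj := mulVec_injective_iff_isUnit.2 hunit (hzero.trans (mulVec_zero _).symm)
  ext i
  have h1 := congrFun (sub_eq_zero.1 hinj) i
  rw [hC, ← map_ofReal_pow, map_ofReal_mulVec] at h1
  have h2 : (((A ^ r *ᵥ y) i : ℝ) : ℂ) = ((ρ ^ r * y i : ℝ) : ℂ) := by
    rw [h1]; simp [Y, hc]
  exact_mod_cast h2

/-! ### Real eigenvalues of natural matrices with natural eigenvectors -/

/-- The eigenvalue is a quotient of natural numbers, and it is an algebraic integer as a root of
the characteristic polynomial. -/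
theorem exists_natCast_eq_of_mulVec_eq_smul {B : Matrix n n ℕ} {d : n → ℕ} {c : ℝ}
    (h : B.map ((↑) : ℕ → ℝ) *ᵥ (fun i => (d i : ℝ)) = c • fun i => (d i : ℝ))
    {i : n} (hi : d i ≠ 0) : ∃ m : ℕ, c = m := by
  have hdi : (d i : ℝ) ≠ 0 := by exact_mod_cast hi
  have hint : IsIntegral ℤ c := by
    have hmem : c ∈ spectrum ℝ (B.map ((↑) : ℕ → ℝ)) :=
      mem_spectrum_iff_exists_mulVec.2 ⟨_, fun h0 => hdi (congrFun h0 i), h⟩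
    rw [mem_spectrum_iff_isRoot_charpoly] at hmem
    have hmap : B.map ((↑) : ℕ → ℝ) = (B.map ((↑) : ℕ → ℤ)).map (Int.castRingHom ℝ) := by
      ext; simp
    rw [hmap, charpoly_map] at hmem
    exact ⟨_, charpoly_monic _, by rw [← Polynomial.eval_map]; exact hmem⟩
  have hc : c = ((∑ j, B i j * d j : ℕ) : ℝ) / d i := by
    rw [eq_div_iff hdi]
    have := congrFun h i
    simp only [mulVec, dotProduct, map_apply, Pi.smul_apply, smul_eq_mul] at this
    push_cast
    exact this.symm
  have hcq : c = algebraMap ℚ ℝ (((∑ j, B i j * d j : ℕ) : ℚ) / d i) := by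
    rw [hc]; simp
  rw [hcq, isIntegral_algebraMap_iff (algebraMap ℚ ℝ).injective,
    IsIntegrallyClosed.isIntegral_iff] at hint
  obtain ⟨a, ha⟩ := hint
  have hca : c = (a : ℝ) := by rw [hcq, ← ha]; simp
  have ha0 : (0 : ℝ) ≤ a := by rw [← hca, hc]; positivity
  lift a to ℕ using (by exact_mod_cast ha0)
  exact ⟨a, by simpa using hca⟩

end Matrix

/-! ### Outdegrees and arc values -/

namespace MultiDigraph

open scoped Matrix

variable {V : Type*} [Quiver V]

variable (V) in
/-- The adjacency matrix, regarded as a real matrix. -/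
noncomputable def realAdjMatrix : Matrix V V ℝ :=
  (adjMatrix V).map ((↑) : ℕ → ℝ)

variable (V) in
theorem map_ofReal_realAdjMatrix :
    (realAdjMatrix V).map ((↑) : ℝ → ℂ) = complexAdjMatrix V := by
  ext i j
  simp [realAdjMatrix, complexAdjMatrix]

theorem realAdjMatrix_pos_iff {i j : V} [Finite (i ⟶ j)] :
    0 < realAdjMatrix V i j ↔ Nonempty (i ⟶ j) := by
  rw [← Finite.card_pos_iff]
  exact Nat.cast_pos

variable [Fintype V] [DecidableEq V]

variable (V) in
theorem rho_eq : rho V = (realAdjMatrix V).realSpectralRadius := by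
  rw [rho, Matrix.realSpectralRadius, map_ofReal_realAdjMatrix]

variable (V) in
theorem imprimitivityIndex_eq :
    imprimitivityIndex V = (realAdjMatrix V).peripheralSpectrum.ncard := by
  rw [imprimitivityIndex, Matrix.peripheralSpectrum, map_ofReal_realAdjMatrix, rho_eq]

variable (V) in
theorem realAdjMatrix_pow (m : ℕ) :
    realAdjMatrix V ^ m = (adjMatrix V ^ m).map ((↑) : ℕ → ℝ) :=
  (Matrix.map_pow (adjMatrix V) (Nat.castRingHom ℝ) m).symm

theorem natCast_outdegree (k : ℕ) (i : V) :
    (outdegree k i : ℝ) = (realAdjMatrix V ^ k *ᵥ 1) i := by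
  simp [outdegree, realAdjMatrix_pow, Matrix.mulVec, dotProduct]

theorem realAdjMatrix_pow_mulVec_outdegree (m k : ℕ) :
    (realAdjMatrix V ^ m *ᵥ fun i => (outdegree k i : ℝ)) = fun i => (outdegree (k + m) i : ℝ) := by
  ext i
  simp only [natCast_outdegree]
  rw [add_comm, pow_add, ← Matrix.mulVec_mulVec]

theorem outdegree_pos (hA : (realAdjMatrix V).IsIrreducible) (k : ℕ) (i : V) :
    0 < outdegree k i := by
  have h : (0 : ℝ) < outdegree k i := by
    rw [natCast_outdegree]
    exact hA.pow_mulVec_pos (fun _ => one_pos) k i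
  exact_mod_cast h

variable [∀ i j : V, Finite (i ⟶ j)]

theorem isIrreducible_realAdjMatrix (hG : Quiver.IsStronglyConnected V) {a b : V} (e : a ⟶ b) :
    (realAdjMatrix V).IsIrreducible := by
  have hnn : ∀ i j, 0 ≤ realAdjMatrix V i j := fun i j => Nat.cast_nonneg _
  have hpos : ∀ {i j : V} (p : Quiver.Path i j), 0 < (realAdjMatrix V ^ p.length) i j := by
    intro i j p
    induction p with
    | nil => simp
    | @cons l j p f ih =>
      rw [Quiver.Path.length_cons, pow_succ, Matrix.mul_apply]
      exact Finset.sum_pos' (fun t _ => mul_nonneg (Matrix.pow_apply_nonneg hnn _ _ _) (hnn _ _))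
        ⟨l, Finset.mem_univ l, mul_pos ih (realAdjMatrix_pos_iff.2 ⟨f⟩)⟩
  refine (Matrix.isIrreducible_iff_exists_pow_pos hnn).2 fun i j => ?_
  -- A path from `i` to `j` through the arc `e` has positive length.
  obtain ⟨p⟩ := hG i a
  obtain ⟨q⟩ := hG b j
  exact ⟨_, by simp, hpos ((p.cons e).comp q)⟩

/-- If all arc values bound the spectral radius from the same side, then the `k`-outdegrees form an
eigenvector of the `(N + 1)`-st power of the adjacency matrix: summing the inequalities over the
arcs out of `i` compares `A ^ (N + 1) d` with `ρ ^ (N + 1) d`, for `d = A ^ k 1`. -/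
theorem pow_mulVec_outdegree_eq [Nonempty V] (hA : (realAdjMatrix V).IsIrreducible) {k N : ℕ}
    (h : rho V ∈ lowerBounds (arcValues V k N) ∨ rho V ∈ upperBounds (arcValues V k N)) :
    (realAdjMatrix V ^ (N + 1) *ᵥ fun i => (outdegree k i : ℝ))
      = rho V ^ (N + 1) • fun i => (outdegree k i : ℝ) := by
  have hd : ∀ (m : ℕ) (i : V), 0 < (outdegree m i : ℝ) := fun m i =>
    Nat.cast_pos.2 (outdegree_pos hA m i)
  have hρ : 0 ≤ rho V := by rw [rho_eq]; exact Matrix.realSpectralRadius_nonneg _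
  have hval : ∀ i j : V, 0 ≤ (outdegree (k + 1) i : ℝ) * outdegree (k + N) j /
      (outdegree k i * outdegree k j) := fun i j => by positivity
  have hpow : ∀ x : ℝ, 0 ≤ x → (x ^ ((1 : ℝ) / ((N : ℝ) + 1))) ^ (N + 1) = x := fun x hx => by
    have := Real.rpow_inv_natCast_pow hx (Nat.succ_ne_zero N)
    rw [one_div]
    exact_mod_cast this
  have hstep : ∀ i, outdegree (k + 1) i * (realAdjMatrix V ^ (N + 1) *ᵥ
      fun i => (outdegree k i : ℝ)) i =
      ∑ j, realAdjMatrix V i j * (outdegree (k + 1) i * outdegree (k + N) j) := fun i => by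
    rw [pow_succ', ← Matrix.mulVec_mulVec, realAdjMatrix_pow_mulVec_outdegree, Matrix.mulVec,
      dotProduct, Finset.mul_sum]
    exact Finset.sum_congr rfl fun j _ => by ring
  have hstep' : ∀ i, outdegree (k + 1) i * (rho V ^ (N + 1) * outdegree k i)
      = ∑ j, realAdjMatrix V i j *
        (rho V ^ (N + 1) * (outdegree k i * outdegree k j)) := fun i => by
    have h1 := congrFun (realAdjMatrix_pow_mulVec_outdegree (V := V) 1 k) i
    simp only [pow_one, Matrix.mulVec, dotProduct] at h1
    rw [← h1, Finset.sum_mul]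
    exact Finset.sum_congr rfl fun j _ => by ring
  have hd0 : (0 : V → ℝ) ≤ fun i => (outdegree k i : ℝ) := fun i => (hd k i).le
  have hne : (fun i => (outdegree k i : ℝ)) ≠ (0 : V → ℝ) := fun h0 =>
    (hd k (Classical.arbitrary V)).ne' (congrFun h0 _)
  -- The entry `(i, j)` of the adjacency matrix vanishes unless there is an arc from `i` to `j`.
  have hentry : ∀ i j {x y : ℝ}, (Nonempty (i ⟶ j) → x ≤ y) →
      realAdjMatrix V i j * x ≤ realAdjMatrix V i j * y := fun i j x y hxy => by
    rcases (hA.nonneg i j).eq_or_lt with h0 | h0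
    · simp [← h0]
    · exact mul_le_mul_of_nonneg_left (hxy (realAdjMatrix_pos_iff.1 h0)) h0.le
  rcases h with h | h
  · rw [rho_eq]
    refine hA.pow_mulVec_eq_of_le hd0 hne fun i => le_of_mul_le_mul_left ?_ (hd (k + 1) i)
    rw [hstep, ← rho_eq, Pi.smul_apply, smul_eq_mul, hstep']
    refine Finset.sum_le_sum fun j _ => hentry i j fun hij => ?_
    have h1 := pow_le_pow_left₀ hρ (h ⟨i, j, hij, rfl⟩) (N + 1)
    rwa [hpow _ (hval i j), le_div_iff₀ (mul_pos (hd k i) (hd k j))] at h1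
  · rw [rho_eq]
    refine hA.pow_mulVec_eq_of_ge hd0 hne fun i => le_of_mul_le_mul_left ?_ (hd (k + 1) i)
    rw [hstep, ← rho_eq, Pi.smul_apply, smul_eq_mul, hstep']
    refine Finset.sum_le_sum fun j _ => hentry i j fun hij => ?_
    have h1 := pow_le_pow_left₀ (Real.rpow_nonneg (hval i j) _) (h ⟨i, j, hij, rfl⟩) (N + 1)
    rwa [hpow _ (hval i j), div_le_iff₀ (mul_pos (hd k i) (hd k j))] at h1

end MultiDigraph

theorem mainTheorem4 {V : Type*} [Fintype V] [DecidableEq V] [Nonempty V] [Quiver V]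
    [∀ i j : V, Finite (i ⟶ j)]
    (hG : Quiver.IsStronglyConnected V) (k N : ℕ)
    (hEq : IsLeast (MultiDigraph.arcValues V k N) (MultiDigraph.rho V) ∨
      IsGreatest (MultiDigraph.arcValues V k N) (MultiDigraph.rho V)) :
    ∃ m : ℕ, MultiDigraph.rho V ^ Nat.gcd (N + 1) (MultiDigraph.imprimitivityIndex V) = (m : ℝ) := by
  obtain ⟨a, b, ⟨e⟩, _⟩ := hEq.elim And.left And.left
  have hA := MultiDigraph.isIrreducible_realAdjMatrix hG e
  have h := MultiDigraph.pow_mulVec_outdegree_eq hA (hEq.imp And.right And.right)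
  rw [MultiDigraph.rho_eq] at h ⊢
  have hgcd := hA.pow_gcd_mulVec_eq N.succ_pos h
  rw [MultiDigraph.realAdjMatrix_pow] at hgcd
  rw [MultiDigraph.imprimitivityIndex_eq]
  exact Matrix.exists_natCast_eq_of_mulVec_eq_smul hgcd
    (MultiDigraph.outdegree_pos hA k a).ne'
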